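/- For a finite group $G$, a $G$-transfer system is a partial order $\to$ on the set of subgroups of $G$ that refines inclusion ($K\to H$ implies $K\le H$) and is closed under restriction ($K\to H$ and $L\le H$ imply $K\cap L\to H\cap L$) and conjugation ($K\to H$ implies $gKg^{-1}\to gHg^{-1}$ for all $g\in G$). A generating set of a transfer system $T$ is a set $S$ of arrows $K\to H$ whose closure under reflexivity, transitivity, restriction and conjugation is $T$; it is minimal if no proper subset of $S$ generates $T$. All minimal generating sets of $T$ have the same number of arrows, denoted $m(T)$, and the complexity of $G$ is $c(G)=\max_T m(T)$, the maximum being over all $G$-transfer systems $T$. Theorem D. Let $p$ be an odd prime and let $D_{p^n}$ denote the dihedral group of order $2p^n$. Then for every $n\ge 1$ \[ c(D_{p^n})=\left\lfloor\frac{3n}{2}\right\rfloor+1=\begin{cases}3k+1 & \text{if } n=2k,\\ 3k+2 & \text{if } n=2k+1.\end{cases} \] In particular, the sequence $c(D_{p^n})$, $n=1,2,3,\dots$, is strictly increasing, and its values are precisely the integers $\ge 2$ that are not divisible by $3$. -/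

import Mathlib

/-- The conjugate `g K g⁻¹` of a subgroup `K`. -/
def conjSubgroup {G : Type*} [Group G] (g : G) (K : Subgroup G) : Subgroup G :=
  K.map (MulAut.conj g).toMonoidHom

/-- A transfer system on a group `G`: a relation `K → H` on the subgroups of `G` that refines
inclusion, is reflexive and transitive, and is closed under restriction and conjugation.
(Antisymmetry is a consequence of `le_of_rel`.) -/
@[ext]
structure TransferSystem (G : Type*) [Group G] where
  Rel : Subgroup G → Subgroup G → Prop
  le_of_rel : ∀ {K H : Subgroup G}, Rel K H → K ≤ H
  refl : ∀ H : Subgroup G, Rel H H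
  trans : ∀ {L K H : Subgroup G}, Rel L K → Rel K H → Rel L H
  restrict : ∀ {K H L : Subgroup G}, Rel K H → L ≤ H → Rel (K ⊓ L) (H ⊓ L)
  conj : ∀ {K H : Subgroup G} (g : G), Rel K H → Rel (conjSubgroup g K) (conjSubgroup g H)

namespace TransferSystem

variable {G : Type*} [Group G]

/-- The closure of a set `S` of arrows (the pair `(K, H)` stands for the arrow `K → H`) under
reflexivity, transitivity, restriction and conjugation. -/
inductive Closure (S : Set (Subgroup G × Subgroup G)) : Subgroup G → Subgroup G → Prop
  | basic {K H : Subgroup G} : (K, H) ∈ S → Closure S K H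
  | refl (H : Subgroup G) : Closure S H H
  | trans {L K H : Subgroup G} : Closure S L K → Closure S K H → Closure S L H
  | restrict {K H L : Subgroup G} : Closure S K H → L ≤ H → Closure S (K ⊓ L) (H ⊓ L)
  | conj {K H : Subgroup G} (g : G) :
      Closure S K H → Closure S (conjSubgroup g K) (conjSubgroup g H)

/-- `S` is a generating set of `T`: the closure of `S` is `T`. -/
def Generates (S : Set (Subgroup G × Subgroup G)) (T : TransferSystem G) : Prop :=
  ∀ K H : Subgroup G, Closure S K H ↔ T.Rel K H

/-- `S` is a minimal generating set of `T`: it generates `T` and no proper subset of it does. -/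
def IsMinimalGeneratingSet (S : Set (Subgroup G × Subgroup G)) (T : TransferSystem G) : Prop :=
  Minimal (fun S' => Generates S' T) S

/-- `m(T)`: the number of arrows in a minimal generating set of `T`. For a finite group this is
the common size of all minimal generating sets of `T`, see `exists_isMinimalGeneratingSet` and
`IsMinimalGeneratingSet.ncard_eq_minGenSize` below. -/
noncomputable def minGenSize (T : TransferSystem G) : ℕ :=
  sInf {k : ℕ | ∃ S, IsMinimalGeneratingSet S T ∧ S.ncard = k}

end TransferSystem

/-- The complexity `c(G)` of a (finite) group `G`: the maximum of `m(T)` over all transfer systems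
`T` on `G`. (A finite group has only finitely many transfer systems.) -/
noncomputable def complexity (G : Type*) [Group G] : ℕ :=
  sSup (Set.range fun T : TransferSystem G => T.minGenSize)

section WellDefined

namespace TransferSystem

variable {G : Type*} [Group G]

theorem conjSubgroup_inf (g : G) (K L : Subgroup G) :
    conjSubgroup g (K ⊓ L) = conjSubgroup g K ⊓ conjSubgroup g L :=
  Subgroup.map_inf _ _ _ (MulAut.conj g).injective

theorem conjSubgroup_mono (g : G) {K L : Subgroup G} (h : K ≤ L) :
    conjSubgroup g K ≤ conjSubgroup g L :=
  Subgroup.map_mono h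

theorem conjSubgroup_one (K : Subgroup G) : conjSubgroup 1 K = K := by
  ext x
  simp [conjSubgroup, Subgroup.mem_map]

theorem conjSubgroup_mul (g h : G) (K : Subgroup G) :
    conjSubgroup (g * h) K = conjSubgroup g (conjSubgroup h K) := by
  simp only [conjSubgroup, Subgroup.map_map]
  congr 1
  ext x
  simp [mul_assoc]

theorem card_conjSubgroup (g : G) (K : Subgroup G) :
    Nat.card (conjSubgroup g K) = Nat.card K :=
  Nat.card_congr (K.equivMapOfInjective _ (MulAut.conj g).injective).symm.toEquiv

theorem card_mono [Finite G] {K L : Subgroup G} (h : K ≤ L) : Nat.card K ≤ Nat.card L :=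
  Nat.card_mono (Set.toFinite _) h

theorem Closure.mono {S S' : Set (Subgroup G × Subgroup G)} (hS : ∀ a ∈ S, Closure S' a.1 a.2)
    {K H : Subgroup G} (h : Closure S K H) : Closure S' K H := by
  induction h with
  | basic h => exact hS _ h
  | refl H => exact .refl H
  | trans _ _ h1 h2 => exact .trans h1 h2
  | restrict _ hL h => exact .restrict h hL
  | conj g _ h => exact .conj g h

/-- One step: `K → L` is a restriction of a conjugate of the arrow `a`. -/
def Step (a : Subgroup G × Subgroup G) (K L : Subgroup G) : Prop :=
  ∃ g : G, L ≤ conjSubgroup g a.2 ∧ K = conjSubgroup g a.1 ⊓ L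

theorem Step.closure {S : Set (Subgroup G × Subgroup G)} {a : Subgroup G × Subgroup G}
    (ha : Closure S a.1 a.2) {K L : Subgroup G} (h : Step a K L) : Closure S K L := by
  obtain ⟨g, hL, rfl⟩ := h
  have := Closure.restrict (Closure.conj g ha) hL
  rwa [inf_eq_right.2 hL] at this

theorem Closure.steps {S : Set (Subgroup G × Subgroup G)} (hS : ∀ a ∈ S, a.1 ≤ a.2)
    {K H : Subgroup G} (h : Closure S K H) :
    Relation.ReflTransGen (fun K L => ∃ a ∈ S, Step a K L) K H := by
  induction h with
  | @basic K H h =>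
    refine .single ⟨_, h, 1, ?_, ?_⟩
    · rw [conjSubgroup_one]
    · rw [conjSubgroup_one]
      exact (inf_eq_left.2 (hS _ h)).symm
  | refl H => exact .refl
  | trans _ _ h1 h2 => exact h1.trans h2
  | @restrict K H L _ _ h =>
    refine Relation.ReflTransGen.lift (fun M => M ⊓ L) ?_ _ _ h
    rintro A B ⟨a, ha, g, hB, rfl⟩
    exact ⟨a, ha, g, inf_le_left.trans hB, inf_assoc _ _ _⟩
  | @conj K H g _ h =>
    refine Relation.ReflTransGen.lift (fun M => conjSubgroup g M) ?_ _ _ h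
    rintro A B ⟨a, ha, k, hB, rfl⟩
    refine ⟨a, ha, g * k, ?_, ?_⟩
    · rw [conjSubgroup_mul]
      exact conjSubgroup_mono g hB
    · rw [conjSubgroup_mul]
      exact conjSubgroup_inf _ _ _

theorem Closure.exists_step {S : Set (Subgroup G × Subgroup G)} (hS : ∀ a ∈ S, a.1 ≤ a.2)
    {K H : Subgroup G} (h : Closure S K H) (hne : K ≠ H) :
    ∃ a ∈ S, ∃ L, K < L ∧ Step a K L ∧ Closure S L H := by
  have key := h.steps hS
  induction key using Relation.ReflTransGen.head_induction_on with
  | refl => exact absurd rfl hne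
  | @head K L hKL hLH ih =>
    have hLH' : Closure S L H := by
      clear ih hKL
      induction hLH using Relation.ReflTransGen.head_induction_on with
      | refl => exact .refl H
      | head hab _ ih =>
        obtain ⟨a, ha, hab⟩ := hab
        exact .trans (hab.closure (.basic ha)) ih
    obtain ⟨a, ha, hst⟩ := hKL
    by_cases hKeq : K = L
    · subst hKeq
      exact ih hLH' hne
    · have hle : K ≤ L := by
        obtain ⟨g, _, rfl⟩ := hst
        exact inf_le_right
      exact ⟨a, ha, L, lt_of_le_of_ne hle hKeq, hst, hLH'⟩

theorem Closure.filter [Finite G] {S : Set (Subgroup G × Subgroup G)} {T : TransferSystem G}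
    (hS : Generates S T) {K H : Subgroup G} (h : Closure S K H) :
    Closure {a ∈ S | Nat.card K ≤ Nat.card a.1} K H := by
  have mono : ∀ {m m' : ℕ} {K H : Subgroup G}, m' ≤ m →
      Closure {a ∈ S | m ≤ Nat.card a.1} K H → Closure {a ∈ S | m' ≤ Nat.card a.1} K H :=
    fun {m m' K H} hm h => by
      refine h.mono ?_
      rintro a ⟨ha, ha'⟩
      exact .basic ⟨ha, hm.trans ha'⟩
  induction h with
  | basic h => exact .basic ⟨h, le_rfl⟩
  | refl H => exact .refl H
  | trans h1 _ ih1 ih2 =>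
    exact .trans ih1 (mono (card_mono (T.le_of_rel ((hS _ _).1 h1))) ih2)
  | restrict _ hL ih => exact .restrict (mono (card_mono inf_le_left) ih) hL
  | conj g _ ih =>
    rw [card_conjSubgroup]
    exact .conj g ih

theorem Generates.le {S : Set (Subgroup G × Subgroup G)} {T : TransferSystem G}
    (hS : Generates S T) : ∀ a ∈ S, a.1 ≤ a.2 :=
  fun _ ha => T.le_of_rel ((hS _ _).1 (.basic ha))

theorem IsMinimalGeneratingSet.not_closure {S : Set (Subgroup G × Subgroup G)}
    {T : TransferSystem G} (hS : IsMinimalGeneratingSet S T) {a : Subgroup G × Subgroup G}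
    (ha : a ∈ S) : ¬ Closure (S \ {a}) a.1 a.2 := by
  intro h
  have hgen : Generates (S \ {a}) T := by
    intro K H
    rw [← hS.prop K H]
    refine ⟨fun h' => h'.mono fun b hb => .basic hb.1, fun h' => h'.mono fun b hb => ?_⟩
    by_cases hba : b = a
    · subst hba
      exact h
    · exact .basic ⟨hb, hba⟩
  exact (hS.le_of_le hgen Set.sdiff_subset ha).2 rfl

theorem IsMinimalGeneratingSet.ne {S : Set (Subgroup G × Subgroup G)}
    {T : TransferSystem G} (hS : IsMinimalGeneratingSet S T) {a : Subgroup G × Subgroup G}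
    (ha : a ∈ S) : a.1 ≠ a.2 := by
  intro h
  apply hS.not_closure ha
  rw [h]
  exact .refl _

/-- The arrow `a` of `T` starts with a proper restriction of a conjugate of `b`. -/
def Starts (T : TransferSystem G) (a b : Subgroup G × Subgroup G) : Prop :=
  ∃ L, a.1 < L ∧ Step b a.1 L ∧ T.Rel L a.2

theorem IsMinimalGeneratingSet.exists_starts {S S' : Set (Subgroup G × Subgroup G)}
    {T : TransferSystem G} (hS : IsMinimalGeneratingSet S T) (hS' : IsMinimalGeneratingSet S' T)
    (a : S) : ∃ b : S', Starts T a b := by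
  have h : Closure S' a.1.1 a.1.2 := (hS'.prop _ _).2 ((hS.prop _ _).1 (.basic a.2))
  obtain ⟨b, hb, L, hL, hst, hc⟩ := h.exists_step hS'.prop.le (hS.ne a.2)
  exact ⟨⟨b, hb⟩, L, hL, hst, (hS'.prop _ _).1 hc⟩

theorem IsMinimalGeneratingSet.eq_of_starts [Finite G] {S : Set (Subgroup G × Subgroup G)}
    {T : TransferSystem G} (hS : IsMinimalGeneratingSet S T) {a b c : Subgroup G × Subgroup G}
    (ha : a ∈ S) (hc : c ∈ S) (hab : Starts T a b) (hbc : Starts T b c) : c = a := by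
  by_contra hca
  apply hS.not_closure ha
  have big : ∀ {L H : Subgroup G}, Nat.card a.1 < Nat.card L → T.Rel L H →
      Closure (S \ {a}) L H := by
    intro L H hL h
    refine (((hS.prop _ _).2 h).filter hS.prop).mono ?_
    rintro d ⟨hd, hd'⟩
    refine .basic ⟨hd, ?_⟩
    rintro rfl
    exact absurd hd' (not_le.2 hL)
  have card_lt : ∀ {K L : Subgroup G}, K < L → Nat.card K < Nat.card L := by
    intro K L h
    refine lt_of_le_of_ne (card_mono h.le) fun he => h.ne ?_
    exact Subgroup.eq_of_le_of_card_ge h.le he.ge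
  obtain ⟨L, hL, hst, hr⟩ := hab
  obtain ⟨L', hL', hst', hr'⟩ := hbc
  have hcard : Nat.card a.1 ≤ Nat.card b.1 := by
    obtain ⟨g, _, h⟩ := hst
    rw [h, ← card_conjSubgroup g b.1]
    exact card_mono inf_le_left
  have hc' : Closure (S \ {a}) c.1 c.2 := by
    refine .basic ⟨hc, ?_⟩
    simpa using hca
  have hb : Closure (S \ {a}) b.1 b.2 :=
    .trans (hst'.closure hc') (big (hcard.trans_lt (card_lt hL')) hr')
  exact .trans (hst.closure hb) (big (card_lt hL) hr)

/-- Any two minimal generating sets of a transfer system have the same size. -/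
theorem IsMinimalGeneratingSet.ncard_eq [Finite G] {S S' : Set (Subgroup G × Subgroup G)}
    {T : TransferSystem G} (hS : IsMinimalGeneratingSet S T) (hS' : IsMinimalGeneratingSet S' T) :
    S.ncard = S'.ncard := by
  choose f hf using hS.exists_starts hS'
  choose k hk using hS'.exists_starts hS
  exact Nat.card_congr
    { toFun := f
      invFun := k
      left_inv := fun a => Subtype.ext (hS.eq_of_starts a.2 (k (f a)).2 (hf a) (hk (f a)))
      right_inv := fun b => Subtype.ext (hS'.eq_of_starts b.2 (f (k b)).2 (hk b) (hf (k b))) }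

theorem exists_isMinimalGeneratingSet [Finite G] (T : TransferSystem G) :
    ∃ S, IsMinimalGeneratingSet S T := by
  have hne : ({S | Generates S T} : Set (Set (Subgroup G × Subgroup G))).Nonempty := by
    refine ⟨{a | T.Rel a.1 a.2}, fun K H => ⟨fun h => ?_, fun h => .basic h⟩⟩
    induction h with
    | basic h => exact h
    | refl H => exact T.refl H
    | trans _ _ h1 h2 => exact T.trans h1 h2
    | restrict _ hL h => exact T.restrict h hL
    | conj g _ h => exact T.conj g h
  exact (Set.toFinite _).exists_minimal hne

/-- For a finite group, `minGenSize T` is the size of any minimal generating set of `T`. -/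
theorem IsMinimalGeneratingSet.ncard_eq_minGenSize [Finite G]
    {S : Set (Subgroup G × Subgroup G)} {T : TransferSystem G}
    (hS : IsMinimalGeneratingSet S T) : S.ncard = T.minGenSize := by
  have h : {k : ℕ | ∃ S, IsMinimalGeneratingSet S T ∧ S.ncard = k} = {S.ncard} := by
    ext k
    constructor
    · rintro ⟨S', hS', rfl⟩
      exact hS'.ncard_eq hS
    · rintro rfl
      exact ⟨S, hS, rfl⟩
  rw [minGenSize, h, csInf_singleton]

end TransferSystem

end WellDefined

/-!
The subgroups of the dihedral group of order `2 p ^ n` are the rotation subgroups `C i` of order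
`p ^ i` (`rotSubgroup`) and the dihedral subgroups `D i x` of order `2 p ^ i` (`dihSubgroup`), for
levels `i ≤ n`. As `p` is odd, the `D i x` of a level `i` are all conjugate, so that a transfer
system is determined by the pairs of levels of its arrows `C i → C j`, `C i → D j` and `D i → D j`
(`TransferSystem.rel_of_levels`).

*Upper bound.* All minimal generating sets have the same size, so it is enough to find a small
generating set of each transfer system. Take the longest arrow of each of the three kinds out of
each level, except where it follows from the arrows out of higher levels together with, for
`C i → C j`, the restrictions of the longest arrow out of `D i`, and, for `C i → D j`, the arrows
from `C i` to rotation subgroups. This generates, by downward induction on the level of the source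
(`TransferSystem.generates_sourceArrows`).
- If both an arrow `C i → C j` and an arrow out of `D i` are retained, let `s i` be the largest
  level that `C i` reaches through a restriction of the latter. Nothing leaves `C (s i)` or
  `D (s i)` for a higher level of the same kind, and `s` is injective and misses `n`. Hence there
  are at most `n` retained arrows of these two kinds
  (`TransferSystem.card_rotRotSources_add_card_dihDihSources_le`).
- If `N` is the largest level with an arrow `C N → D N`, then the retained arrows `C i → D j` have
  `i ≤ N ≤ j`, distinct `i`, and distinct `j`, so there are at most `(n + 2) / 2` of them
  (`TransferSystem.two_mul_card_rotDihSources_le`).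

Together these are at most `n + n / 2 + 1 = 3 n / 2 + 1` arrows.

*Lower bound.* For `k = n / 2`, the `n + k + 1` arrows `C i → D (2 k - i)` (`i ≤ k`),
`D i → D (i + 1)` (`i < k`) and `C i → C (i + 1)` (`k ≤ i < n`) are independent, since for each of
them there is a transfer system that contains all the others but not this one
(`LevelSystem.extremal`, `LevelSystem.exists_minGenSize_eq`).
-/

/-! ### Subgroups of dihedral groups of order `2 p ^ n` -/

namespace DihedralGroup

variable {p n : ℕ}

/-- The subgroup of order `p ^ i` of the rotations of the dihedral group of order `2 p ^ n`
(for `i ≤ n`), as the rotations `r a` with `p ^ i * a = 0`. -/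
def rotSubgroup (p n i : ℕ) : Subgroup (DihedralGroup (p ^ n)) where
  carrier := {g | match g with
    | r a => (p : ZMod (p ^ n)) ^ i * a = 0
    | sr _ => False}
  one_mem' := mul_zero _
  mul_mem' := by
    rintro (a | a) (b | b) ha hb
    · exact (mul_add _ _ _).trans (by rw [show _ * a = 0 from ha, show _ * b = 0 from hb, add_zero])
    all_goals first | exact ha.elim | exact hb.elim
  inv_mem' := by
    rintro (a | a) ha
    · exact (mul_neg _ _).trans (by rw [show _ * a = 0 from ha, neg_zero])
    · exact ha.elim

/-- The subgroup of order `2 p ^ i` (for `i ≤ n`) that contains the reflection `sr x`, in the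
dihedral group of order `2 p ^ n`. -/
def dihSubgroup (p n i : ℕ) (x : ZMod (p ^ n)) : Subgroup (DihedralGroup (p ^ n)) where
  carrier := {g | match g with
    | r a => (p : ZMod (p ^ n)) ^ i * a = 0
    | sr a => (p : ZMod (p ^ n)) ^ i * (a - x) = 0}
  one_mem' := mul_zero _
  mul_mem' := by
    rintro (a | a) (b | b) ha hb <;> simp only [Set.mem_ofPred_eq] at ha hb
    · change _ * (a + b) = 0
      linear_combination ha + hb
    · change _ * (b - a - x) = 0
      linear_combination hb - ha
    · change _ * (a + b - x) = 0
      linear_combination ha + hb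
    · change _ * (b - a) = 0
      linear_combination hb - ha
  inv_mem' := by
    rintro (a | a) ha
    · exact (mul_neg _ _).trans (by rw [show _ * a = 0 from ha, neg_zero])
    · exact ha

@[simp]
theorem r_mem_rotSubgroup {i : ℕ} {a : ZMod (p ^ n)} :
    r a ∈ rotSubgroup p n i ↔ (p : ZMod (p ^ n)) ^ i * a = 0 := Iff.rfl

@[simp]
theorem sr_mem_rotSubgroup {i : ℕ} {a : ZMod (p ^ n)} :
    sr a ∈ rotSubgroup p n i ↔ False := Iff.rfl

@[simp]
theorem r_mem_dihSubgroup {i : ℕ} {x a : ZMod (p ^ n)} :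
    r a ∈ dihSubgroup p n i x ↔ (p : ZMod (p ^ n)) ^ i * a = 0 := Iff.rfl

@[simp]
theorem sr_mem_dihSubgroup {i : ℕ} {x a : ZMod (p ^ n)} :
    sr a ∈ dihSubgroup p n i x ↔ (p : ZMod (p ^ n)) ^ i * (a - x) = 0 := Iff.rfl

theorem pow_min_mul_eq_zero_iff {i j : ℕ} {a : ZMod (p ^ n)} :
    (p : ZMod (p ^ n)) ^ min i j * a = 0 ↔
      (p : ZMod (p ^ n)) ^ i * a = 0 ∧ (p : ZMod (p ^ n)) ^ j * a = 0 := by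
  refine ⟨fun h => ⟨pow_mul_eq_zero_of_le (min_le_left _ _) h,
    pow_mul_eq_zero_of_le (min_le_right _ _) h⟩, fun h => ?_⟩
  rcases min_choice i j with h' | h' <;> rw [h']
  exacts [h.1, h.2]

theorem rotSubgroup_mono {i j : ℕ} (h : i ≤ j) : rotSubgroup p n i ≤ rotSubgroup p n j := by
  rintro (a | a) ha
  · exact pow_mul_eq_zero_of_le h ha
  · exact ha

theorem rotSubgroup_le_dihSubgroup {i j : ℕ} (h : i ≤ j) (x : ZMod (p ^ n)) :
    rotSubgroup p n i ≤ dihSubgroup p n j x := by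
  rintro (a | a) ha
  · exact pow_mul_eq_zero_of_le h ha
  · exact ha.elim

theorem dihSubgroup_mono {i j : ℕ} (h : i ≤ j) (x : ZMod (p ^ n)) :
    dihSubgroup p n i x ≤ dihSubgroup p n j x := by
  rintro (a | a) ha
  · exact pow_mul_eq_zero_of_le h ha
  · exact pow_mul_eq_zero_of_le h ha

theorem dihSubgroup_congr {j : ℕ} {x y : ZMod (p ^ n)}
    (h : (p : ZMod (p ^ n)) ^ j * (x - y) = 0) : dihSubgroup p n j x = dihSubgroup p n j y := by
  ext (a | a)
  · rfl
  · simp only [sr_mem_dihSubgroup]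
    constructor
    · intro h'
      linear_combination h' + h
    · intro h'
      linear_combination h' - h

theorem not_dihSubgroup_le_rotSubgroup {i j : ℕ} {x : ZMod (p ^ n)} :
    ¬ dihSubgroup p n i x ≤ rotSubgroup p n j :=
  fun h => @h (sr x) (by simp)

theorem rotSubgroup_ne_dihSubgroup {i j : ℕ} {x : ZMod (p ^ n)} :
    rotSubgroup p n i ≠ dihSubgroup p n j x :=
  fun h => not_dihSubgroup_le_rotSubgroup h.ge

theorem rotSubgroup_inf_rotSubgroup (i j : ℕ) :
    rotSubgroup p n i ⊓ rotSubgroup p n j = rotSubgroup p n (min i j) := by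
  ext (a | a)
  · simp [pow_min_mul_eq_zero_iff]
  · simp

theorem rotSubgroup_inf_dihSubgroup (i j : ℕ) (x : ZMod (p ^ n)) :
    rotSubgroup p n i ⊓ dihSubgroup p n j x = rotSubgroup p n (min i j) := by
  ext (a | a)
  · simp [pow_min_mul_eq_zero_iff]
  · simp

theorem dihSubgroup_inf_dihSubgroup (i j : ℕ) (x : ZMod (p ^ n)) :
    dihSubgroup p n i x ⊓ dihSubgroup p n j x = dihSubgroup p n (min i j) x := by
  ext (a | a)
  · simp [pow_min_mul_eq_zero_iff]
  · simp [pow_min_mul_eq_zero_iff]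

/-- The reflections of two subgroups `dihSubgroup p n i x` and `dihSubgroup p n j y` form cosets of
two nested groups, so they are nested or disjoint; this is the disjoint case. -/
theorem dihSubgroup_inf_dihSubgroup_of_ne (i j : ℕ) {x y : ZMod (p ^ n)}
    (h : (p : ZMod (p ^ n)) ^ max i j * (x - y) ≠ 0) :
    dihSubgroup p n i x ⊓ dihSubgroup p n j y = rotSubgroup p n (min i j) := by
  ext (a | a)
  · simp [pow_min_mul_eq_zero_iff]
  · simp only [Subgroup.mem_inf, sr_mem_dihSubgroup, sr_mem_rotSubgroup, iff_false, not_and]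
    intro h1 h2
    have h1' := pow_mul_eq_zero_of_le (le_max_left i j) h1
    have h2' := pow_mul_eq_zero_of_le (le_max_right i j) h2
    exact h (by linear_combination h2' - h1')

theorem mem_conjSubgroup {G : Type*} [Group G] {g x : G} {K : Subgroup G} :
    x ∈ conjSubgroup g K ↔ g⁻¹ * x * g ∈ K := by
  constructor
  · rintro ⟨y, hy, rfl⟩
    simpa [mul_assoc] using hy
  · intro h
    exact ⟨_, h, by simp [mul_assoc]⟩

theorem conjSubgroup_rotSubgroup (g : DihedralGroup (p ^ n)) (i : ℕ) :
    conjSubgroup g (rotSubgroup p n i) = rotSubgroup p n i := by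
  rcases g with b | b <;> ext (a | a) <;> simp [mem_conjSubgroup]

theorem conjSubgroup_r_dihSubgroup (b : ZMod (p ^ n)) (i : ℕ) (x : ZMod (p ^ n)) :
    conjSubgroup (r b) (dihSubgroup p n i x) = dihSubgroup p n i (x - 2 * b) := by
  ext (a | a) <;> simp only [mem_conjSubgroup, inv_r, r_mul_r, r_mul_sr, sr_mul_r,
    r_mem_dihSubgroup, sr_mem_dihSubgroup]
  · ring_nf
  · ring_nf

theorem conjSubgroup_sr_dihSubgroup (b : ZMod (p ^ n)) (i : ℕ) (x : ZMod (p ^ n)) :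
    conjSubgroup (sr b) (dihSubgroup p n i x) = dihSubgroup p n i (2 * b - x) := by
  ext (a | a) <;> simp only [mem_conjSubgroup, inv_sr, sr_mul_sr, r_mul_sr, sr_mul_r,
    r_mem_dihSubgroup, sr_mem_dihSubgroup]
  · rw [← neg_eq_zero]
    ring_nf
  · rw [← neg_eq_zero]
    ring_nf

theorem exists_conjSubgroup_dihSubgroup (g : DihedralGroup (p ^ n)) (x : ZMod (p ^ n)) :
    ∃ y, ∀ i, conjSubgroup g (dihSubgroup p n i x) = dihSubgroup p n i y := by
  rcases g with b | b
  · exact ⟨_, fun i => conjSubgroup_r_dihSubgroup b i x⟩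
  · exact ⟨_, fun i => conjSubgroup_sr_dihSubgroup b i x⟩

/-- As `p` is odd, `2` is invertible in `ZMod (p ^ n)`, and so all reflections are conjugate. -/
theorem exists_conjSubgroup_dihSubgroup_eq (hodd : Odd p) (x y : ZMod (p ^ n)) :
    ∃ g, ∀ i, conjSubgroup g (dihSubgroup p n i x) = dihSubgroup p n i y := by
  have h2 : IsUnit (2 : ZMod (p ^ n)) := by
    have := (ZMod.isUnit_iff_coprime 2 (p ^ n)).2 (Nat.coprime_two_left.2 hodd.pow)
    simpa using this
  obtain ⟨u, hu⟩ := h2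
  refine ⟨r (↑u⁻¹ * (x - y)), fun i => ?_⟩
  rw [conjSubgroup_r_dihSubgroup, ← hu, Units.mul_inv_cancel_left]
  simp

section Prime

variable [hp : Fact p.Prime]

theorem natCast_pow_eq_zero_iff {m : ℕ} : (p : ZMod (p ^ n)) ^ m = 0 ↔ n ≤ m := by
  rw [← Nat.cast_pow, ZMod.natCast_eq_zero_iff, Nat.pow_dvd_pow_iff_le_right hp.out.one_lt]

/-- The rotation that separates `rotSubgroup p n i` from the smaller ones. -/
theorem pow_mul_pow_sub_eq_zero_iff {i j : ℕ} (hi : i ≤ n) :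
    (p : ZMod (p ^ n)) ^ j * (p : ZMod (p ^ n)) ^ (n - i) = 0 ↔ i ≤ j := by
  rw [← pow_add, natCast_pow_eq_zero_iff]
  omega

theorem level_le_of_forall {i j : ℕ} (hi : i ≤ n)
    (h : ∀ a : ZMod (p ^ n), (p : ZMod (p ^ n)) ^ i * a = 0 → (p : ZMod (p ^ n)) ^ j * a = 0) :
    i ≤ j :=
  (pow_mul_pow_sub_eq_zero_iff hi).1 (h _ ((pow_mul_pow_sub_eq_zero_iff hi).2 le_rfl))

theorem rotSubgroup_le_rotSubgroup_iff {i j : ℕ} (hi : i ≤ n) :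
    rotSubgroup p n i ≤ rotSubgroup p n j ↔ i ≤ j :=
  ⟨fun h => level_le_of_forall hi fun a ha => @h (r a) ha, rotSubgroup_mono⟩

theorem rotSubgroup_le_dihSubgroup_iff {i j : ℕ} (hi : i ≤ n) {x : ZMod (p ^ n)} :
    rotSubgroup p n i ≤ dihSubgroup p n j x ↔ i ≤ j :=
  ⟨fun h => level_le_of_forall hi fun a ha => @h (r a) ha, fun h => rotSubgroup_le_dihSubgroup h x⟩

theorem dihSubgroup_le_dihSubgroup_iff {i j : ℕ} (hi : i ≤ n) {x y : ZMod (p ^ n)} :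
    dihSubgroup p n i x ≤ dihSubgroup p n j y ↔
      i ≤ j ∧ (p : ZMod (p ^ n)) ^ j * (x - y) = 0 := by
  refine ⟨fun h => ⟨level_le_of_forall hi fun a ha => @h (r a) ha, @h (sr x) (by simp)⟩, ?_⟩
  rintro ⟨h, h'⟩
  rw [← dihSubgroup_congr h']
  exact dihSubgroup_mono h x

theorem rotSubgroup_inj {i j : ℕ} (hi : i ≤ n) (hj : j ≤ n)
    (h : rotSubgroup p n i = rotSubgroup p n j) : i = j :=
  le_antisymm ((rotSubgroup_le_rotSubgroup_iff hi).1 h.le)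
    ((rotSubgroup_le_rotSubgroup_iff hj).1 h.ge)

theorem dihSubgroup_inj {i j : ℕ} (hi : i ≤ n) (hj : j ≤ n) {x y : ZMod (p ^ n)}
    (h : dihSubgroup p n i x = dihSubgroup p n j y) :
    i = j ∧ (p : ZMod (p ^ n)) ^ j * (x - y) = 0 :=
  ⟨le_antisymm ((dihSubgroup_le_dihSubgroup_iff hi).1 h.le).1
    ((dihSubgroup_le_dihSubgroup_iff hj).1 h.ge).1,
    ((dihSubgroup_le_dihSubgroup_iff hi).1 h.le).2⟩

/-- A subgroup of the cyclic group `ZMod (p ^ n)` consists of the elements killed by its order. -/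
theorem exists_forall_mem_addSubgroup_iff (Q : AddSubgroup (ZMod (p ^ n))) :
    ∃ i ≤ n, ∀ a, a ∈ Q ↔ (p : ZMod (p ^ n)) ^ i * a = 0 := by
  classical
  have hcard : Nat.card Q ∣ p ^ n := by
    simpa using Q.card_addSubgroup_dvd_card
  obtain ⟨i, hi, hQ⟩ := (Nat.dvd_prime_pow hp.out).1 hcard
  refine ⟨i, hi, ?_⟩
  have hsub : (Q : Set (ZMod (p ^ n))).toFinset ⊆
      Finset.univ.filter fun a : ZMod (p ^ n) => p ^ i • a = 0 := by
    intro a ha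
    have ha' : a ∈ Q := by simpa using ha
    have : Nat.card Q • (⟨a, ha'⟩ : Q) = 0 := card_nsmul_eq_zero'
    rw [hQ] at this
    simpa using congrArg Subtype.val this
  have heq := Finset.eq_of_subset_of_card_le hsub (by
    rw [Set.toFinset_card, ← Nat.card_eq_fintype_card, SetLike.coe_sort_coe, hQ]
    exact IsAddCyclic.card_nsmul_eq_zero_le (pow_pos hp.out.pos i))
  intro a
  have := Finset.ext_iff.1 heq a
  simpa using this

theorem exists_eq_rotSubgroup_or_dihSubgroup (H : Subgroup (DihedralGroup (p ^ n))) :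
    (∃ i ≤ n, H = rotSubgroup p n i) ∨ ∃ i ≤ n, ∃ x, H = dihSubgroup p n i x := by
  obtain ⟨i, hi, hQ⟩ := exists_forall_mem_addSubgroup_iff (p := p) (n := n)
    { carrier := {a | r a ∈ H}
      zero_mem' := H.one_mem
      add_mem' := fun {a b} ha hb => H.mul_mem (x := r a) (y := r b) ha hb
      neg_mem' := fun {a} ha => H.inv_mem (x := r a) ha }
  replace hQ : ∀ a, r a ∈ H ↔ (p : ZMod (p ^ n)) ^ i * a = 0 := hQ
  by_cases hs : ∃ x, sr x ∈ H
  · obtain ⟨x, hx⟩ := hs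
    refine .inr ⟨i, hi, x, ?_⟩
    ext (a | a)
    · exact hQ a
    · rw [← H.mul_mem_cancel_left hx, sr_mul_sr, hQ, sr_mem_dihSubgroup]
  · refine .inl ⟨i, hi, ?_⟩
    ext (a | a)
    · exact hQ a
    · exact iff_of_false (fun h => hs ⟨a, h⟩) id

end Prime

end DihedralGroup

/-! ### Generating sets and independent families of arrows -/

namespace TransferSystem

section Generation

variable {G : Type*} [Group G]

theorem Closure.rel {S : Set (Subgroup G × Subgroup G)} {T : TransferSystem G}
    (hS : ∀ a ∈ S, T.Rel a.1 a.2) {K H : Subgroup G} (h : Closure S K H) : T.Rel K H := by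
  induction h with
  | basic h => exact hS _ h
  | refl H => exact T.refl H
  | trans _ _ h1 h2 => exact T.trans h1 h2
  | restrict _ hL h => exact T.restrict h hL
  | conj g _ h => exact T.conj g h

/-- The transfer system generated by a set of arrows. -/
def generate (S : Set (Subgroup G × Subgroup G)) (hS : ∀ a ∈ S, a.1 ≤ a.2) : TransferSystem G where
  Rel := Closure S
  le_of_rel := by
    intro K H h
    induction h with
    | basic h => exact hS _ h
    | refl H => exact le_rfl
    | trans _ _ h1 h2 => exact h1.trans h2
    | restrict _ hL h => exact inf_le_inf_right _ h
    | conj g _ h => exact conjSubgroup_mono g h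
  refl := .refl
  trans := .trans
  restrict := .restrict
  conj := .conj

theorem generates_generate (S : Set (Subgroup G × Subgroup G)) (hS : ∀ a ∈ S, a.1 ≤ a.2) :
    Generates S (generate S hS) :=
  fun _ _ => Iff.rfl

theorem minGenSize_le_ncard [Finite G] {S : Set (Subgroup G × Subgroup G)} {T : TransferSystem G}
    (hS : Generates S T) : T.minGenSize ≤ S.ncard := by
  obtain ⟨S', hle, hmin⟩ :=
    (Set.toFinite {S' : Set (Subgroup G × Subgroup G) | Generates S' T}).exists_le_minimal hS
  have hmin' : IsMinimalGeneratingSet S' T := hmin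
  rw [← hmin'.ncard_eq_minGenSize]
  exact Set.ncard_le_ncard hle (Set.toFinite S)

/-- A family of arrows generates a transfer system of the full size if, for each index, some
transfer system contains all of the other arrows but not this one. -/
theorem exists_minGenSize_eq_card [Finite G] {ι : Type*} (f : ι → Subgroup G × Subgroup G)
    (hle : ∀ x, (f x).1 ≤ (f x).2)
    (hind : ∀ x, ∃ T : TransferSystem G,
      (∀ y, y ≠ x → T.Rel (f y).1 (f y).2) ∧ ¬ T.Rel (f x).1 (f x).2) :
    ∃ T : TransferSystem G, T.minGenSize = Nat.card ι := by
  have hinj : Function.Injective f := by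
    intro x y hxy
    by_contra hne
    obtain ⟨T, h1, h2⟩ := hind x
    exact h2 (hxy ▸ h1 y (Ne.symm hne))
  have hS : ∀ a ∈ Set.range f, a.1 ≤ a.2 := by
    rintro _ ⟨x, rfl⟩
    exact hle x
  refine ⟨generate (Set.range f) hS, ?_⟩
  have hmin : IsMinimalGeneratingSet (Set.range f) (generate (Set.range f) hS) := by
    refine ⟨generates_generate _ hS, fun S' hgen hsub => ?_⟩
    rintro _ ⟨x, rfl⟩
    by_contra hx
    obtain ⟨T, h1, h2⟩ := hind x
    refine h2 (Closure.rel (S := S') ?_ ((hgen _ _).2 (.basic ⟨x, rfl⟩)))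
    intro a ha
    obtain ⟨y, rfl⟩ := hsub ha
    exact h1 y fun hyx => hx (hyx ▸ ha)
  rw [← hmin.ncard_eq_minGenSize, ← Set.image_univ, Set.ncard_image_of_injective _ hinj,
    Set.ncard_univ]

end Generation

/-! ### Transfer systems on dihedral groups in terms of levels -/

section Levels

open DihedralGroup

variable {p n : ℕ} (T : TransferSystem (DihedralGroup (p ^ n)))

/-- The arrows of `T` between rotation subgroups, in terms of their levels. -/
def RotRot (i j : ℕ) : Prop := T.Rel (rotSubgroup p n i) (rotSubgroup p n j)

/-- The arrows of `T` from rotation subgroups to dihedral subgroups, in terms of their levels. -/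
def RotDih (i j : ℕ) : Prop := T.Rel (rotSubgroup p n i) (dihSubgroup p n j 0)

/-- The arrows of `T` between dihedral subgroups, in terms of their levels. -/
def DihDih (i j : ℕ) : Prop := T.Rel (dihSubgroup p n i 0) (dihSubgroup p n j 0)

variable {T}

theorem RotRot.refl (i : ℕ) : T.RotRot i i := T.refl _

theorem RotRot.trans {i j k : ℕ} (h : T.RotRot i j) (h' : T.RotRot j k) : T.RotRot i k :=
  T.trans (K := rotSubgroup p n j) h h'

theorem RotRot.trans_rotDih {i j k : ℕ} (h : T.RotRot i j) (h' : T.RotDih j k) : T.RotDih i k :=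
  T.trans (K := rotSubgroup p n j) h h'

theorem RotRot.restrict {i j k : ℕ} (h : T.RotRot i j) (hik : i ≤ k) (hkj : k ≤ j) :
    T.RotRot i k := by
  have := T.restrict h (rotSubgroup_mono hkj)
  rwa [rotSubgroup_inf_rotSubgroup, rotSubgroup_inf_rotSubgroup, min_eq_left hik,
    min_eq_right hkj] at this

theorem RotDih.rotRot {i j k : ℕ} (h : T.RotDih i j) (hik : i ≤ k) (hkj : k ≤ j) :
    T.RotRot i k := by
  have := T.restrict h (rotSubgroup_le_dihSubgroup hkj 0)
  rwa [rotSubgroup_inf_rotSubgroup, inf_eq_right.2 (rotSubgroup_le_dihSubgroup hkj 0),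
    min_eq_left hik] at this

theorem RotDih.restrict {i j k : ℕ} (h : T.RotDih i j) (hkj : k ≤ j) :
    T.RotDih (min i k) k := by
  have := T.restrict h (dihSubgroup_mono hkj 0)
  rwa [rotSubgroup_inf_dihSubgroup, dihSubgroup_inf_dihSubgroup, min_eq_right hkj] at this

theorem DihDih.rotRot {i j k : ℕ} (h : T.DihDih i j) (hik : i ≤ k) (hkj : k ≤ j) :
    T.RotRot i k := by
  have := T.restrict h (rotSubgroup_le_dihSubgroup hkj 0)
  rwa [inf_comm, rotSubgroup_inf_dihSubgroup, inf_eq_right.2 (rotSubgroup_le_dihSubgroup hkj 0),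
    min_eq_right hik] at this

theorem DihDih.restrict {i j k : ℕ} (h : T.DihDih i j) (hik : i ≤ k) (hkj : k ≤ j) :
    T.DihDih i k := by
  have := T.restrict h (dihSubgroup_mono hkj 0)
  rwa [dihSubgroup_inf_dihSubgroup, dihSubgroup_inf_dihSubgroup, min_eq_left hik,
    min_eq_right hkj] at this

variable [hp : Fact p.Prime]

theorem RotRot.le {i j : ℕ} (hi : i ≤ n) (h : T.RotRot i j) : i ≤ j :=
  (rotSubgroup_le_rotSubgroup_iff hi).1 (T.le_of_rel h)

theorem RotDih.le {i j : ℕ} (hi : i ≤ n) (h : T.RotDih i j) : i ≤ j :=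
  (rotSubgroup_le_dihSubgroup_iff hi).1 (T.le_of_rel h)

theorem DihDih.le {i j : ℕ} (hi : i ≤ n) (h : T.DihDih i j) : i ≤ j :=
  ((dihSubgroup_le_dihSubgroup_iff hi).1 (T.le_of_rel h)).1

/-- A transfer system on a dihedral group is determined by its arrows in terms of levels. -/
theorem rel_of_levels (hodd : Odd p) {T T' : TransferSystem (DihedralGroup (p ^ n))}
    (hrr : ∀ i ≤ n, ∀ j ≤ n, T.RotRot i j → T'.RotRot i j)
    (hrd : ∀ i ≤ n, ∀ j ≤ n, T.RotDih i j → T'.RotDih i j)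
    (hdd : ∀ i ≤ n, ∀ j ≤ n, T.DihDih i j → T'.DihDih i j)
    {K H : Subgroup (DihedralGroup (p ^ n))} (h : T.Rel K H) : T'.Rel K H := by
  rcases exists_eq_rotSubgroup_or_dihSubgroup K with ⟨i, hi, rfl⟩ | ⟨i, hi, x, rfl⟩ <;>
  rcases exists_eq_rotSubgroup_or_dihSubgroup H with ⟨j, hj, rfl⟩ | ⟨j, hj, y, rfl⟩
  · exact hrr i hi j hj h
  · obtain ⟨g, hg⟩ := exists_conjSubgroup_dihSubgroup_eq hodd y 0
    obtain ⟨g', hg'⟩ := exists_conjSubgroup_dihSubgroup_eq hodd 0 y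
    have h1 := T.conj g h
    rw [conjSubgroup_rotSubgroup, hg] at h1
    have h2 := T'.conj g' (hrd i hi j hj h1)
    rwa [conjSubgroup_rotSubgroup, hg'] at h2
  · exact absurd (T.le_of_rel h) not_dihSubgroup_le_rotSubgroup
  · have hle := (dihSubgroup_le_dihSubgroup_iff hi).1 (T.le_of_rel h)
    rw [← dihSubgroup_congr hle.2] at h ⊢
    obtain ⟨g, hg⟩ := exists_conjSubgroup_dihSubgroup_eq hodd x 0
    obtain ⟨g', hg'⟩ := exists_conjSubgroup_dihSubgroup_eq hodd 0 x
    have h1 := T.conj g h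
    rw [hg, hg] at h1
    have h2 := T'.conj g' (hdd i hi j hj h1)
    rwa [hg', hg'] at h2

end Levels

/-! ### A small generating set -/

section UpperBound

open DihedralGroup Classical

variable {p n : ℕ} (T : TransferSystem (DihedralGroup (p ^ n)))

/-- The largest level that the rotation subgroup of level `i` reaches among rotation subgroups. -/
noncomputable def maxRotRot (i : ℕ) : ℕ := Nat.findGreatest (T.RotRot i) n

/-- The largest level that the rotation subgroup of level `i` reaches among dihedral subgroups
(meaningful if it reaches any). -/
noncomputable def maxRotDih (i : ℕ) : ℕ := Nat.findGreatest (T.RotDih i) n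

/-- The largest level that the dihedral subgroup of level `i` reaches. -/
noncomputable def maxDihDih (i : ℕ) : ℕ := Nat.findGreatest (T.DihDih i) n

variable {T}

theorem rotRot_maxRotRot {i : ℕ} (hi : i ≤ n) : T.RotRot i (T.maxRotRot i) :=
  Nat.findGreatest_spec (P := T.RotRot i) hi (T.refl _)

theorem RotRot.le_max {i j : ℕ} (h : T.RotRot i j) (hj : j ≤ n) : j ≤ T.maxRotRot i :=
  Nat.le_findGreatest hj h

theorem RotDih.maxRotDih {i j : ℕ} (h : T.RotDih i j) (hj : j ≤ n) :
    T.RotDih i (T.maxRotDih i) :=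
  Nat.findGreatest_spec (P := T.RotDih i) hj h

theorem RotDih.le_max {i j : ℕ} (h : T.RotDih i j) (hj : j ≤ n) : j ≤ T.maxRotDih i :=
  Nat.le_findGreatest hj h

theorem dihDih_maxDihDih {i : ℕ} (hi : i ≤ n) : T.DihDih i (T.maxDihDih i) :=
  Nat.findGreatest_spec (P := T.DihDih i) hi (T.refl _)

theorem DihDih.le_max {i j : ℕ} (h : T.DihDih i j) (hj : j ≤ n) : j ≤ T.maxDihDih i :=
  Nat.le_findGreatest hj h

theorem maxRotRot_le (i : ℕ) : T.maxRotRot i ≤ n := Nat.findGreatest_le n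

theorem maxRotDih_le (i : ℕ) : T.maxRotDih i ≤ n := Nat.findGreatest_le n

theorem maxDihDih_le (i : ℕ) : T.maxDihDih i ≤ n := Nat.findGreatest_le n

variable (T)

/-- The levels `i` such that a dihedral subgroup of level `i` is the source of a proper arrow. -/
noncomputable def dihDihSources : Finset ℕ :=
  (Finset.range (n + 1)).filter fun i => i < T.maxDihDih i

/-- The levels `i` such that the longest arrow between rotation subgroups out of level `i` is proper
and does not factor through a restriction of the longest arrow between dihedral subgroups out
of level `i`. -/
noncomputable def rotRotSources : Finset ℕ :=
  (Finset.range (n + 1)).filter fun i => i < T.maxRotRot i ∧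
    ∀ k, i < k → k ≤ T.maxDihDih i → ¬ T.RotRot k (T.maxRotRot i)

/-- The levels `i` such that the longest arrow to a dihedral subgroup from the rotation subgroup of
level `i` is not implied by such an arrow of a higher level, neither by restriction alone nor by
precomposition. -/
noncomputable def rotDihSources : Finset ℕ :=
  (Finset.range (n + 1)).filter fun i => T.RotDih i i ∧
    ∀ k, i < k → k ≤ n → (T.maxRotDih i = i → ¬ T.RotDih k k) ∧
      (T.RotRot i k → ¬ T.RotDih k (T.maxRotDih i))

/-- The longest arrows out of the three sets of sources. -/
noncomputable def sourceArrows :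
    Finset (Subgroup (DihedralGroup (p ^ n)) × Subgroup (DihedralGroup (p ^ n))) :=
  (T.rotRotSources.image fun i => (rotSubgroup p n i, rotSubgroup p n (T.maxRotRot i))) ∪
  (T.rotDihSources.image fun i => (rotSubgroup p n i, dihSubgroup p n (T.maxRotDih i) 0)) ∪
  (T.dihDihSources.image fun i => (dihSubgroup p n i 0, dihSubgroup p n (T.maxDihDih i) 0))

theorem card_sourceArrows_le :
    T.sourceArrows.card ≤ T.rotRotSources.card + T.rotDihSources.card + T.dihDihSources.card :=
  (Finset.card_union_le _ _).trans (add_le_add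
    ((Finset.card_union_le _ _).trans (add_le_add Finset.card_image_le Finset.card_image_le))
    Finset.card_image_le)

variable {T}

theorem rel_of_mem_sourceArrows
    {a : Subgroup (DihedralGroup (p ^ n)) × Subgroup (DihedralGroup (p ^ n))}
    (ha : a ∈ T.sourceArrows) : T.Rel a.1 a.2 := by
  simp only [sourceArrows, Finset.mem_union, Finset.mem_image] at ha
  rcases ha with (⟨i, hi, rfl⟩ | ⟨i, hi, rfl⟩) | ⟨i, hi, rfl⟩
  · exact rotRot_maxRotRot (Finset.mem_range_succ_iff.1 (Finset.mem_filter.1 hi).1)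
  · have := Finset.mem_filter.1 hi
    exact this.2.1.maxRotDih (Finset.mem_range_succ_iff.1 this.1)
  · exact dihDih_maxDihDih (Finset.mem_range_succ_iff.1 (Finset.mem_filter.1 hi).1)

/-- If `i` is a source of both kinds, then the largest level `s i` that level `i` reaches through a
restriction of its arrow between dihedral subgroups is a source of neither kind, and `s` is
injective and misses `n`. -/
theorem card_rotRotSources_add_card_dihDihSources_le :
    T.rotRotSources.card + T.dihDihSources.card ≤ n := by
  let reach : ℕ → ℕ → Prop := fun i r => ∃ k, i < k ∧ k ≤ T.maxDihDih i ∧ T.RotRot k r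
  let s : ℕ → ℕ := fun i => Nat.findGreatest (reach i) n
  have memA : ∀ {i}, i ∈ T.rotRotSources ↔ i ≤ n ∧ i < T.maxRotRot i ∧
      ∀ k, i < k → k ≤ T.maxDihDih i → ¬ T.RotRot k (T.maxRotRot i) := by
    simp [rotRotSources]
  have memE : ∀ {i}, i ∈ T.dihDihSources ↔ i ≤ n ∧ i < T.maxDihDih i := by
    simp [dihDihSources]
  have hs : ∀ {i}, i ∈ T.rotRotSources ∩ T.dihDihSources → reach i (s i) := by
    intro i hi
    have hE := (memE.1 (Finset.mem_inter.1 hi).2).2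
    exact Nat.findGreatest_spec (P := reach i) (maxDihDih_le i) ⟨_, hE, le_rfl, T.refl _⟩
  have hle : ∀ {i r}, reach i r → r ≤ n → r ≤ s i := fun h hr => Nat.le_findGreatest hr h
  have hsn : ∀ i, s i ≤ n := fun i => Nat.findGreatest_le n
  have hlt : ∀ {i}, i ∈ T.rotRotSources ∩ T.dihDihSources → s i < T.maxRotRot i := by
    intro i hi
    obtain ⟨hin, -, hA⟩ := memA.1 (Finset.mem_inter.1 hi).1
    obtain ⟨k, hik, hk, hkr⟩ := hs hi
    refine lt_of_le_of_ne ?_ fun heq => hA k hik hk (heq ▸ hkr)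
    exact (((dihDih_maxDihDih hin).rotRot hik.le hk).trans hkr).le_max (hsn i)
  have hmaps : Set.MapsTo s (T.rotRotSources ∩ T.dihDihSources : Finset ℕ)
      (Finset.range n \ (T.rotRotSources ∪ T.dihDihSources) : Finset ℕ) := by
    intro i hi
    obtain ⟨k, hik, hk, hkr⟩ := hs hi
    have h := hlt hi
    simp only [Finset.coe_sdiff, Finset.coe_union, Set.mem_sdiff, Finset.mem_coe, Finset.mem_range,
      Set.mem_union, not_or]
    refine ⟨h.trans_le (maxRotRot_le i), fun hA => ?_, fun hE => ?_⟩
    · have h1 := (memA.1 hA).2.1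
      exact absurd (hle ⟨k, hik, hk, hkr.trans (rotRot_maxRotRot (hsn i))⟩ (maxRotRot_le _))
        (not_le.2 h1)
    · have h1 := (memE.1 hE).2
      exact absurd (hle ⟨k, hik, hk, hkr.trans ((dihDih_maxDihDih (hsn i)).rotRot h1.le le_rfl)⟩
        (maxDihDih_le _)) (not_le.2 h1)
  have key : ∀ i ∈ T.rotRotSources ∩ T.dihDihSources, ∀ j ∈ T.rotRotSources ∩ T.dihDihSources,
      s i = s j → ¬ i < j := by
    intro i hi j hj heq hij
    obtain ⟨hjn, hjm⟩ := memE.1 (Finset.mem_inter.1 hj).2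
    have hjs : j < s j := hjm.trans_le (hle ⟨_, hjm, le_rfl, T.refl _⟩ (maxDihDih_le j))
    have hbig := hlt hj
    obtain ⟨k, hik, hk, hkr⟩ := hs hi
    have hreach : reach i (T.maxRotRot j) := by
      by_cases hjk : j ≤ T.maxDihDih i
      · exact ⟨j, hij, hjk, rotRot_maxRotRot hjn⟩
      · exact ⟨k, hik, hk, (hkr.restrict (by omega) (by omega)).trans (rotRot_maxRotRot hjn)⟩
    have := hle hreach (maxRotRot_le j)
    omega
  have hinj : Set.InjOn s (T.rotRotSources ∩ T.dihDihSources : Finset ℕ) := by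
    intro i hi j hj heq
    have h1 := key i hi j hj heq
    have h2 := key j hj i hi heq.symm
    omega
  have hcard := Finset.card_le_card_of_injOn s hmaps hinj
  have hsub : T.rotRotSources ∪ T.dihDihSources ⊆ Finset.range n := by
    intro i hi
    rw [Finset.mem_range]
    rcases Finset.mem_union.1 hi with h | h
    · exact (memA.1 h).2.1.trans_le (maxRotRot_le i)
    · exact (memE.1 h).2.trans_le (maxDihDih_le i)
  rw [Finset.card_sdiff_of_subset hsub, Finset.card_range] at hcard
  have h1 := Finset.card_union_add_card_inter T.rotRotSources T.dihDihSources
  have h2 := Finset.card_le_card hsub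
  rw [Finset.card_range] at h2
  omega

variable [hp : Fact p.Prime]

theorem generates_sourceArrows (hodd : Odd p) :
    Generates (T.sourceArrows : Set (Subgroup (DihedralGroup (p ^ n)) × _)) T := by
  set T' := generate (T.sourceArrows : Set (Subgroup (DihedralGroup (p ^ n)) × _))
    fun a ha => T.le_of_rel (rel_of_mem_sourceArrows ha) with hT'
  have basic : ∀ a ∈ T.sourceArrows, T'.Rel a.1 a.2 := fun a ha => Closure.basic ha
  have hdd : ∀ i ≤ n, ∀ j ≤ n, T.DihDih i j → T'.DihDih i j := by
    intro i hi j hj h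
    have hij := h.le hi
    have hmax := h.le_max hj
    suffices T'.DihDih i (T.maxDihDih i) from this.restrict hij hmax
    by_cases hlt : i < T.maxDihDih i
    · refine basic _ (Finset.mem_union_right _ (Finset.mem_image_of_mem _ ?_))
      exact Finset.mem_filter.2 ⟨Finset.mem_range_succ_iff.2 hi, hlt⟩
    · rw [← show i = T.maxDihDih i by omega]
      exact T'.refl _
  -- Downward induction on the level of the source.
  have hrot : ∀ d i, i ≤ n → n - i = d →
      (∀ j ≤ n, T.RotRot i j → T'.RotRot i j) ∧ (∀ j ≤ n, T.RotDih i j → T'.RotDih i j) := by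
    intro d
    induction d using Nat.strong_induction_on with
    | _ d ih =>
    intro i hi hd
    have ih' : ∀ k, i < k → k ≤ n →
        (∀ j ≤ n, T.RotRot k j → T'.RotRot k j) ∧ (∀ j ≤ n, T.RotDih k j → T'.RotDih k j) :=
      fun k hk hkn => ih (n - k) (by omega) k hkn rfl
    have hrr : ∀ j ≤ n, T.RotRot i j → T'.RotRot i j := by
      intro j hj h
      have hij := h.le hi
      have hmax := h.le_max hj
      suffices T'.RotRot i (T.maxRotRot i) from this.restrict hij hmax
      by_cases hmem : i ∈ T.rotRotSources
      · exact basic _ (Finset.mem_union_left _ (Finset.mem_union_left _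
          (Finset.mem_image_of_mem _ hmem)))
      rcases (hij.trans hmax).eq_or_lt with heq | hlt
      · rw [← heq]
        exact T'.refl _
      simp only [rotRotSources, Finset.mem_filter, Finset.mem_range_succ_iff, hi, hlt, true_and,
        not_forall, not_not] at hmem
      obtain ⟨k, hik, hk, hkr⟩ := hmem
      exact ((hdd i hi _ (maxDihDih_le i) (dihDih_maxDihDih hi)).rotRot hik.le hk).trans
        ((ih' k hik (hk.trans (maxDihDih_le i))).1 _ (maxRotRot_le i) hkr)
    refine ⟨hrr, ?_⟩
    intro j hj h
    have hij := h.le hi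
    have hmax := h.le_max hj
    suffices hm : T'.RotDih i (T.maxRotDih i) by
      have := hm.restrict hmax
      rwa [min_eq_left hij] at this
    by_cases hmem : i ∈ T.rotDihSources
    · exact basic _ (Finset.mem_union_left _ (Finset.mem_union_right _
        (Finset.mem_image_of_mem _ hmem)))
    have hii : T.RotDih i i := by
      have := h.restrict hij
      rwa [min_self] at this
    simp only [rotDihSources, Finset.mem_filter, Finset.mem_range_succ_iff, hi, hii, true_and,
      not_forall, not_and_or, not_not] at hmem
    obtain ⟨k, hik, hk, ⟨heq, hkk⟩ | ⟨hik', hkd⟩⟩ := hmem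
    · have := ((ih' k hik hk).2 k hk hkk).restrict hik.le
      rw [min_eq_right hik.le] at this
      rwa [heq]
    · exact (hrr k hk hik').trans_rotDih ((ih' k hik hk).2 _ (maxRotDih_le i) hkd)
  intro K H
  refine ⟨Closure.rel fun a ha => rel_of_mem_sourceArrows ha, fun h => ?_⟩
  exact rel_of_levels (T' := T') hodd (fun i hi => (hrot _ i hi rfl).1)
    (fun i hi => (hrot _ i hi rfl).2) hdd h

/-- Let `N` be the largest level with an arrow from a rotation subgroup to a dihedral subgroup. The
sources lie in `[0, N]`, and their longest arrows have distinct target levels in `[N, n]`. -/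
theorem two_mul_card_rotDihSources_le : 2 * T.rotDihSources.card ≤ n + 2 := by
  have memB : ∀ {i}, i ∈ T.rotDihSources ↔ i ≤ n ∧ T.RotDih i i ∧
      ∀ k, i < k → k ≤ n → (T.maxRotDih i = i → ¬ T.RotDih k k) ∧
        (T.RotRot i k → ¬ T.RotDih k (T.maxRotDih i)) := by
    simp [rotDihSources]
  by_cases hne : ∃ i ≤ n, T.RotDih i i
  swap
  · have : T.rotDihSources = ∅ := by
      refine Finset.eq_empty_of_forall_notMem fun i hi => hne ?_
      exact ⟨i, (memB.1 hi).1, (memB.1 hi).2.1⟩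
    simp [this]
  obtain ⟨i₀, hi₀, hr₀⟩ := hne
  set N := Nat.findGreatest (fun i => T.RotDih i i) n with hN
  have hNN : T.RotDih N N := Nat.findGreatest_spec (P := fun i => T.RotDih i i) hi₀ hr₀
  have hNn : N ≤ n := Nat.findGreatest_le n
  have hleN : ∀ {i}, i ≤ n → T.RotDih i i → i ≤ N := fun hi h => Nat.le_findGreatest hi h
  have hmax : ∀ {i}, i ∈ T.rotDihSources → N ≤ T.maxRotDih i := by
    intro i hi
    obtain ⟨hin, hii, hB⟩ := memB.1 hi
    by_contra! hlt
    have hrel := hii.maxRotDih hin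
    rcases (hrel.le hin).eq_or_lt with heq | hlt'
    · exact (hB N (by omega) hNn).1 heq.symm hNN
    · refine (hB _ hlt' (maxRotDih_le i)).2 (hrel.rotRot hlt'.le le_rfl) ?_
      have := hNN.restrict hlt.le
      rwa [min_eq_right hlt.le] at this
  have key : ∀ i ∈ T.rotDihSources, ∀ j ∈ T.rotDihSources,
      T.maxRotDih i = T.maxRotDih j → ¬ i < j := by
    intro i hi j hj heq hij
    obtain ⟨hin, hii, hB⟩ := memB.1 hi
    obtain ⟨hjn, hjj, -⟩ := memB.1 hj
    have hjN := (hleN hjn hjj).trans (hmax hi)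
    exact (hB j hij hjn).2 ((hii.maxRotDih hin).rotRot hij.le hjN) (heq ▸ hjj.maxRotDih hjn)
  have h1 : T.rotDihSources.card ≤ (Finset.Icc N n).card := by
    refine Finset.card_le_card_of_injOn T.maxRotDih
      (fun i hi => by simpa using ⟨hmax hi, maxRotDih_le i⟩) ?_
    intro i hi j hj heq
    have h1 := key i hi j hj heq
    have h2 := key j hj i hi heq.symm
    omega
  have h2 : T.rotDihSources.card ≤ (Finset.range (N + 1)).card := by
    refine Finset.card_le_card fun i hi => Finset.mem_range_succ_iff.2 ?_
    exact hleN (memB.1 hi).1 (memB.1 hi).2.1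
  rw [Nat.card_Icc] at h1
  rw [Finset.card_range] at h2
  omega

theorem minGenSize_le (hodd : Odd p) (T : TransferSystem (DihedralGroup (p ^ n))) :
    T.minGenSize ≤ 3 * n / 2 + 1 := by
  have h1 := minGenSize_le_ncard (T.generates_sourceArrows hodd)
  rw [Set.ncard_coe_finset] at h1
  have h2 := T.card_sourceArrows_le
  have h3 := T.card_rotRotSources_add_card_dihDihSources_le
  have h4 := T.two_mul_card_rotDihSources_le
  omega

end UpperBound

end TransferSystem

/-! ### Transfer systems from relations on levels -/

/-- A transfer system on the dihedral group of order `2 p ^ n`, in terms of levels: `rr i j`,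
`rd i j`, `dd i j` stand for the arrows between two rotation subgroups, from a rotation subgroup to
a dihedral one, and between two nested dihedral ones. Only their values for `i ≤ j ≤ n` matter. -/
structure LevelSystem (n : ℕ) where
  rr : ℕ → ℕ → Prop
  rd : ℕ → ℕ → Prop
  dd : ℕ → ℕ → Prop
  rr_refl : ∀ i, rr i i
  dd_refl : ∀ i, dd i i
  rr_trans : ∀ {i j k}, i ≤ j → j ≤ k → k ≤ n → rr i j → rr j k → rr i k
  rr_rd : ∀ {i j k}, i ≤ j → j ≤ k → k ≤ n → rr i j → rd j k → rd i k
  rd_dd : ∀ {i j k}, i ≤ j → j ≤ k → k ≤ n → rd i j → dd j k → rd i k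
  dd_trans : ∀ {i j k}, i ≤ j → j ≤ k → k ≤ n → dd i j → dd j k → dd i k
  rr_restrict : ∀ {i j k}, i ≤ j → j ≤ n → k ≤ j → rr i j → rr (min i k) k
  rd_rr : ∀ {i j k}, i ≤ j → j ≤ n → k ≤ j → rd i j → rr (min i k) k
  rd_restrict : ∀ {i j k}, i ≤ j → j ≤ n → k ≤ j → rd i j → rd (min i k) k
  dd_rr : ∀ {i j k}, i ≤ j → j ≤ n → k ≤ j → dd i j → rr (min i k) k
  dd_restrict : ∀ {i j k}, i ≤ j → j ≤ n → k ≤ j → dd i j → dd (min i k) k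
  /-- The restriction to a dihedral subgroup that shares no reflection with the source. -/
  dd_rd : ∀ {i j k}, i < j → j ≤ n → k < j → dd i j → rd (min i k) k

namespace LevelSystem

open DihedralGroup

variable {n : ℕ} (p : ℕ) (D : LevelSystem n)

/-- The relation on subgroups given by relations on levels. -/
inductive Rel : Subgroup (DihedralGroup (p ^ n)) → Subgroup (DihedralGroup (p ^ n)) → Prop
  | rot_rot {i j : ℕ} (hij : i ≤ j) (hj : j ≤ n) (h : D.rr i j) :
      Rel (rotSubgroup p n i) (rotSubgroup p n j)
  | rot_dih {i j : ℕ} (hij : i ≤ j) (hj : j ≤ n) (h : D.rd i j) (x : ZMod (p ^ n)) :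
      Rel (rotSubgroup p n i) (dihSubgroup p n j x)
  | dih_dih {i j : ℕ} (hij : i ≤ j) (hj : j ≤ n) (h : D.dd i j) (x : ZMod (p ^ n)) :
      Rel (dihSubgroup p n i x) (dihSubgroup p n j x)

variable {p D}

theorem Rel.le {K H : Subgroup (DihedralGroup (p ^ n))} (h : D.Rel p K H) : K ≤ H := by
  cases h with
  | rot_rot hij _ _ => exact rotSubgroup_mono hij
  | rot_dih hij _ _ x => exact rotSubgroup_le_dihSubgroup hij x
  | dih_dih hij _ _ x => exact dihSubgroup_mono hij x

theorem Rel.conj {K H : Subgroup (DihedralGroup (p ^ n))} (g : DihedralGroup (p ^ n))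
    (h : D.Rel p K H) : D.Rel p (conjSubgroup g K) (conjSubgroup g H) := by
  cases h with
  | rot_rot hij hj h =>
    simp only [conjSubgroup_rotSubgroup]
    exact .rot_rot hij hj h
  | rot_dih hij hj h x =>
    obtain ⟨y, hy⟩ := exists_conjSubgroup_dihSubgroup g x
    rw [conjSubgroup_rotSubgroup, hy]
    exact .rot_dih hij hj h y
  | dih_dih hij hj h x =>
    obtain ⟨y, hy⟩ := exists_conjSubgroup_dihSubgroup g x
    rw [hy, hy]
    exact .dih_dih hij hj h y

variable [hp : Fact p.Prime]

theorem Rel.refl (H : Subgroup (DihedralGroup (p ^ n))) : D.Rel p H H := by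
  rcases exists_eq_rotSubgroup_or_dihSubgroup H with ⟨i, hi, rfl⟩ | ⟨i, hi, x, rfl⟩
  · exact .rot_rot le_rfl hi (D.rr_refl i)
  · exact .dih_dih le_rfl hi (D.dd_refl i) x

theorem Rel.trans {L K H : Subgroup (DihedralGroup (p ^ n))} (h : D.Rel p L K)
    (h' : D.Rel p K H) : D.Rel p L H := by
  generalize hK : K = K' at h'
  cases h with
  | @rot_rot i j hij hj h =>
    cases h' with
    | @rot_rot j' k hjk hk h' =>
      obtain rfl := rotSubgroup_inj hj (hjk.trans hk) hK
      exact .rot_rot (hij.trans hjk) hk (D.rr_trans hij hjk hk h h')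
    | @rot_dih j' k hjk hk h' x =>
      obtain rfl := rotSubgroup_inj hj (hjk.trans hk) hK
      exact .rot_dih (hij.trans hjk) hk (D.rr_rd hij hjk hk h h') x
    | dih_dih => exact absurd hK rotSubgroup_ne_dihSubgroup
  | @rot_dih i j hij hj h x =>
    cases h' with
    | rot_rot => exact absurd hK.symm rotSubgroup_ne_dihSubgroup
    | rot_dih => exact absurd hK.symm rotSubgroup_ne_dihSubgroup
    | @dih_dih j' k hjk hk h' y =>
      obtain ⟨rfl, hxy⟩ := dihSubgroup_inj hj (hjk.trans hk) hK
      exact .rot_dih (hij.trans hjk) hk (D.rd_dd hij hjk hk h h') y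
  | @dih_dih i j hij hj h x =>
    cases h' with
    | rot_rot => exact absurd hK.symm rotSubgroup_ne_dihSubgroup
    | rot_dih => exact absurd hK.symm rotSubgroup_ne_dihSubgroup
    | @dih_dih j' k hjk hk h' y =>
      obtain ⟨rfl, hxy⟩ := dihSubgroup_inj hj (hjk.trans hk) hK
      rw [← dihSubgroup_congr (pow_mul_eq_zero_of_le hjk hxy)]
      exact .dih_dih (hij.trans hjk) hk (D.dd_trans hij hjk hk h h') x

theorem Rel.restrict {K H L : Subgroup (DihedralGroup (p ^ n))} (h : D.Rel p K H)
    (hL : L ≤ H) : D.Rel p (K ⊓ L) (H ⊓ L) := by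
  rw [inf_eq_right.2 hL]
  rcases exists_eq_rotSubgroup_or_dihSubgroup L with ⟨k, hk, rfl⟩ | ⟨k, hk, y, rfl⟩
  · cases h with
    | rot_rot hij hj h =>
      rw [rotSubgroup_inf_rotSubgroup]
      exact .rot_rot (min_le_right _ _) hk
        (D.rr_restrict hij hj ((rotSubgroup_le_rotSubgroup_iff hk).1 hL) h)
    | rot_dih hij hj h x =>
      rw [rotSubgroup_inf_rotSubgroup]
      exact .rot_rot (min_le_right _ _) hk
        (D.rd_rr hij hj ((rotSubgroup_le_dihSubgroup_iff hk).1 hL) h)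
    | dih_dih hij hj h x =>
      rw [inf_comm, rotSubgroup_inf_dihSubgroup, min_comm]
      exact .rot_rot (min_le_right _ _) hk
        (D.dd_rr hij hj ((rotSubgroup_le_dihSubgroup_iff hk).1 hL) h)
  · cases h with
    | rot_rot => exact absurd hL not_dihSubgroup_le_rotSubgroup
    | rot_dih hij hj h x =>
      rw [rotSubgroup_inf_dihSubgroup]
      exact .rot_dih (min_le_right _ _) hk
        (D.rd_restrict hij hj ((dihSubgroup_le_dihSubgroup_iff hk).1 hL).1 h) y
    | @dih_dih i j hij hj h x =>
      obtain ⟨hkj, hyx⟩ := (dihSubgroup_le_dihSubgroup_iff hk).1 hL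
      by_cases hxy : (p : ZMod (p ^ n)) ^ max i k * (x - y) = 0
      · rcases le_total i k with hik | hki
        · rw [max_eq_right hik] at hxy
          rw [← dihSubgroup_congr hxy, dihSubgroup_inf_dihSubgroup]
          exact .dih_dih (min_le_right _ _) hk (D.dd_restrict hij hj hkj h) x
        · rw [max_eq_left hki] at hxy
          rw [dihSubgroup_congr hxy, dihSubgroup_inf_dihSubgroup]
          exact .dih_dih (min_le_right _ _) hk (D.dd_restrict hij hj hkj h) y
      · have hmax : max i k < j := by
          by_contra! hle
          refine hxy (pow_mul_eq_zero_of_le hle ?_)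
          rw [← neg_sub, mul_neg, hyx, neg_zero]
        rw [dihSubgroup_inf_dihSubgroup_of_ne _ _ hxy]
        exact .rot_dih (min_le_right _ _) hk
          (D.dd_rd ((le_max_left _ _).trans_lt hmax) hj ((le_max_right _ _).trans_lt hmax) h) y

variable (p D)

/-- The transfer system on the dihedral group given by relations on levels. -/
def toTransferSystem : TransferSystem (DihedralGroup (p ^ n)) where
  Rel := D.Rel p
  le_of_rel := Rel.le
  refl := Rel.refl
  trans := Rel.trans
  restrict := Rel.restrict
  conj := Rel.conj

variable {p D}

theorem toTransferSystem_rel_rot_rot_iff {i j : ℕ} (hij : i ≤ j) (hj : j ≤ n) :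
    (D.toTransferSystem p).Rel (rotSubgroup p n i) (rotSubgroup p n j) ↔ D.rr i j := by
  refine ⟨fun h => ?_, .rot_rot hij hj⟩
  change D.Rel p _ _ at h
  generalize hK : rotSubgroup p n i = K, hH : rotSubgroup p n j = H at h
  cases h with
  | rot_rot hij' hj' h =>
    obtain rfl := rotSubgroup_inj (hij.trans hj) (hij'.trans hj') hK
    obtain rfl := rotSubgroup_inj hj hj' hH
    exact h
  | rot_dih => exact absurd hH rotSubgroup_ne_dihSubgroup
  | dih_dih => exact absurd hK rotSubgroup_ne_dihSubgroup

theorem toTransferSystem_rel_rot_dih_iff {i j : ℕ} (hij : i ≤ j) (hj : j ≤ n)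
    (x : ZMod (p ^ n)) :
    (D.toTransferSystem p).Rel (rotSubgroup p n i) (dihSubgroup p n j x) ↔ D.rd i j := by
  refine ⟨fun h => ?_, fun h => .rot_dih hij hj h x⟩
  change D.Rel p _ _ at h
  generalize hK : rotSubgroup p n i = K, hH : dihSubgroup p n j x = H at h
  cases h with
  | rot_rot => exact absurd hH.symm rotSubgroup_ne_dihSubgroup
  | rot_dih hij' hj' h =>
    obtain rfl := rotSubgroup_inj (hij.trans hj) (hij'.trans hj') hK
    obtain rfl := (dihSubgroup_inj hj hj' hH).1
    exact h
  | dih_dih => exact absurd hK rotSubgroup_ne_dihSubgroup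

theorem toTransferSystem_rel_dih_dih_iff {i j : ℕ} (hij : i ≤ j) (hj : j ≤ n)
    (x : ZMod (p ^ n)) :
    (D.toTransferSystem p).Rel (dihSubgroup p n i x) (dihSubgroup p n j x) ↔ D.dd i j := by
  refine ⟨fun h => ?_, fun h => .dih_dih hij hj h x⟩
  change D.Rel p _ _ at h
  generalize hK : dihSubgroup p n i x = K, hH : dihSubgroup p n j x = H at h
  cases h with
  | rot_rot => exact absurd hK.symm rotSubgroup_ne_dihSubgroup
  | rot_dih => exact absurd hK.symm rotSubgroup_ne_dihSubgroup
  | dih_dih hij' hj' h =>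
    obtain rfl := (dihSubgroup_inj (hij.trans hj) (hij'.trans hj') hK).1
    obtain rfl := (dihSubgroup_inj hj hj' hH).1
    exact h

/-! ### The extremal transfer system -/

/-- For `a > n`, `b > k` and `e ≥ k` this is the extremal system, with all arrows between rotation
subgroups, the arrows from rotation level `i` to dihedral level `j` for `i + j ≤ 2 k`, and all
arrows between dihedral subgroups of level at most `k`. Otherwise it leaves out the arrows from
rotation level `a` to higher rotation levels, the longest arrow from rotation level `b ≤ k` to a
dihedral subgroup, or the arrows from dihedral level `e < k` to higher levels. -/
def extremal (n : ℕ) {k a : ℕ} (hka : k ≤ a) (b e : ℕ) : LevelSystem n where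
  rr i j := i = j ∨ i ≠ a
  rd i j := i + j ≤ 2 * k ∧ ¬ (i = b ∧ j = 2 * k - b)
  dd i j := i = j ∨ (j ≤ k ∧ i ≠ e)
  rr_refl := by omega
  dd_refl := by omega
  rr_trans := by omega
  rr_rd := by omega
  rd_dd := by omega
  dd_trans := by omega
  rr_restrict := by omega
  rd_rr := by omega
  rd_restrict := by omega
  dd_rr := by omega
  dd_restrict := by omega
  dd_rd := by omega

/-- A minimal generating set of the extremal system: the arrows from rotation level `i` to dihedral
level `2 k - i` for `i ≤ k`, from dihedral level `i` to `i + 1` for `i < k`, and from rotation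
level `i` to `i + 1` for `k ≤ i < n`. -/
def extremalArrows (p n k : ℕ) : Fin (k + 1) ⊕ Fin k ⊕ Fin (n - k) →
    Subgroup (DihedralGroup (p ^ n)) × Subgroup (DihedralGroup (p ^ n))
  | .inl i => (rotSubgroup p n i, dihSubgroup p n (2 * k - i) 0)
  | .inr (.inl i) => (dihSubgroup p n i 0, dihSubgroup p n (i + 1) 0)
  | .inr (.inr i) => (rotSubgroup p n (k + i), rotSubgroup p n (k + i + 1))

/-- Each of the `extremalArrows` is left out by one system of the family `extremal`, which keeps all
of the others. -/
theorem exists_minGenSize_eq (p : ℕ) [Fact p.Prime] {n k : ℕ} (hk : 2 * k ≤ n) :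
    ∃ T : TransferSystem (DihedralGroup (p ^ n)), T.minGenSize = n + k + 1 := by
  have hrd : ∀ {a} b e (hka : k ≤ a) (i : Fin (k + 1)),
      ((extremal n hka b e).toTransferSystem p).Rel (extremalArrows p n k (.inl i)).1
        (extremalArrows p n k (.inl i)).2 ↔ (i : ℕ) ≠ b := by
    intro a b e hka i
    refine (toTransferSystem_rel_rot_dih_iff (by omega) (by omega) 0).trans ?_
    simp only [extremal]
    omega
  have hdd : ∀ {a} b e (hka : k ≤ a) (i : Fin k),
      ((extremal n hka b e).toTransferSystem p).Rel (extremalArrows p n k (.inr (.inl i))).1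
        (extremalArrows p n k (.inr (.inl i))).2 ↔ (i : ℕ) ≠ e := by
    intro a b e hka i
    refine (toTransferSystem_rel_dih_dih_iff (by omega) (by omega) 0).trans ?_
    simp only [extremal]
    omega
  have hrr : ∀ {a} b e (hka : k ≤ a) (i : Fin (n - k)),
      ((extremal n hka b e).toTransferSystem p).Rel (extremalArrows p n k (.inr (.inr i))).1
        (extremalArrows p n k (.inr (.inr i))).2 ↔ k + (i : ℕ) ≠ a := by
    intro a b e hka i
    refine (toTransferSystem_rel_rot_rot_iff (by omega) (by omega)).trans ?_
    simp only [extremal]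
    omega
  obtain ⟨T, hT⟩ := TransferSystem.exists_minGenSize_eq_card (extremalArrows p n k)
    (by
      rintro (i | i | i)
      · exact rotSubgroup_le_dihSubgroup (by omega) 0
      · exact dihSubgroup_mono (by omega) 0
      · exact rotSubgroup_mono (by omega))
    (by
      rintro (x | x | x)
      · refine ⟨(extremal n (show k ≤ n + 1 by omega) x k).toTransferSystem p, ?_, by simp [hrd]⟩
        rintro (y | y | y) hy
        · rw [hrd]
          simpa [Fin.ext_iff] using hy
        · rw [hdd]
          omega
        · rw [hrr]
          omega
      · refine ⟨(extremal n (show k ≤ n + 1 by omega) (k + 1) x).toTransferSystem p, ?_,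
          by simp [hdd]⟩
        rintro (y | y | y) hy
        · rw [hrd]
          omega
        · rw [hdd]
          simpa [Fin.ext_iff] using hy
        · rw [hrr]
          omega
      · refine ⟨(extremal n (show k ≤ k + x by omega) (k + 1) k).toTransferSystem p, ?_,
          by simp [hrr]⟩
        rintro (y | y | y) hy
        · rw [hrd]
          omega
        · rw [hdd]
          omega
        · rw [hrr]
          simpa [Fin.ext_iff] using hy)
  refine ⟨T, hT.trans ?_⟩
  simp only [Nat.card_eq_fintype_card, Fintype.card_sum, Fintype.card_fin]
  omega

end LevelSystem

/-! ### The complexity -/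

theorem complexity_dihedralGroup (p : ℕ) [Fact p.Prime] (hodd : Odd p) (n : ℕ) :
    complexity (DihedralGroup (p ^ n)) = 3 * n / 2 + 1 := by
  have hub : ∀ m ∈ Set.range fun T : TransferSystem (DihedralGroup (p ^ n)) => T.minGenSize,
      m ≤ 3 * n / 2 + 1 := by
    rintro _ ⟨T, rfl⟩
    exact T.minGenSize_le hodd
  obtain ⟨T, hT⟩ := LevelSystem.exists_minGenSize_eq p (n := n) (k := n / 2) (by omega)
  refine le_antisymm (csSup_le ⟨_, T, rfl⟩ hub) ?_
  rw [show 3 * n / 2 + 1 = T.minGenSize by omega]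
  exact le_csSup ⟨_, hub⟩ ⟨T, rfl⟩

theorem theoremD (p : ℕ) (hp : p.Prime) (hodd : Odd p) :
    (∀ n : ℕ, 1 ≤ n → complexity (DihedralGroup (p ^ n)) = 3 * n / 2 + 1) ∧
    (∀ k : ℕ, 1 ≤ k → complexity (DihedralGroup (p ^ (2 * k))) = 3 * k + 1) ∧
    (∀ k : ℕ, complexity (DihedralGroup (p ^ (2 * k + 1))) = 3 * k + 2) ∧
    StrictMonoOn (fun n : ℕ => complexity (DihedralGroup (p ^ n))) (Set.Ici 1) ∧
    (fun n : ℕ => complexity (DihedralGroup (p ^ n))) '' Set.Ici 1 =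
      {m : ℕ | 2 ≤ m ∧ ¬ 3 ∣ m} := by
  have : Fact p.Prime := ⟨hp⟩
  simp only [complexity_dihedralGroup p hodd]
  refine ⟨fun _ _ => trivial, by omega, by omega, ?_, ?_⟩
  · intro m _ n _ hmn
    simp only
    omega
  · ext m
    simp only [Set.mem_image, Set.mem_Ici, Set.mem_ofPred_eq]
    constructor
    · rintro ⟨n, hn, rfl⟩
      omega
    · intro hm
      exact ⟨2 * (m - 1) / 3 + if m % 3 = 2 then 1 else 0, by split <;> omega, by split <;> omega⟩
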